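/- Let $k_0$ be a perfect field, $k := k_0((x))$ with its $x$-adic topology, and let $k_0((x,y))$ denote the fraction field of $k_0[[x,y]]$. Let $L/K/k_0((x,y))$ be a tower of finite field extensions. Denote by $A$ and $B$ the integral closures of $k_0[[x,y]]$ in $K$ and $L$ respectively, and set $X := \operatorname{Spec} A[x^{-1}]$ and $Y := \operatorname{Spec} B[x^{-1}]$; these are $k$-schemes through $k_0[[x]] \subseteq k_0[[x,y]]$, and $A \subseteq B$ induces a natural $k$-morphism $f : Y \to X$. For a finite field extension $\ell/k$, equipped with its valuation topology (the unique Hausdorff topology making it a topological $k$-vector space), and an affine $k$-scheme $S$, let $S(\ell)$ be the set of $k$-morphisms $\operatorname{Spec}\ell \to S$, with the coarsest topology for which the function $g_* : S(\ell) \to \ell$ induced by $g$ is continuous for every $g \in \Gamma(S\otimes_k \ell, \mathcal{O})$. Let $v \in Y$ be a closed point, with residue field $k(v)$, such that $f$ is étale at $v$ (that is, étale on an open neighbourhood of $v$). Then $k(v)$ is a finite extension of $k$, and the map $f_v : Y(k(v)) \to X(k(v))$ induced by $f$ is a local homeomorphism at $v$, where $v$ is regarded as the element of $Y(k(v))$ given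 by the canonical morphism $\operatorname{Spec} k(v) \to Y$: there is an open neighbourhood $W$ of $v$ in $Y(k(v))$ such that $f_v(W)$ is open in $X(k(v))$ and $f_v$ restricts to a homeomorphism $W \to f_v(W)$. -/

import Mathlib

open scoped LaurentSeries PowerSeries TensorProduct

noncomputable section

namespace ImplicitFunction

/-- The ring `k₀[[x, y]]`, with `x = X 0` and `y = X 1`. -/
abbrev PS2 (k₀ : Type*) [Field k₀] : Type _ := MvPowerSeries (Fin 2) k₀

/-- The field `k₀((x, y))`, the fraction field of `k₀[[x, y]]`. -/
abbrev LS2 (k₀ : Type*) [Field k₀] : Type _ := FractionRing (PS2 k₀)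

/-- The inclusion `k₀[[x]] → k₀[[x, y]]` that sends the variable to `x`. -/
def inclX (k₀ : Type*) [Field k₀] : k₀⟦X⟧ →+* PS2 k₀ :=
  (PowerSeries.substAlgHom (R := k₀) (S := k₀)
    (PowerSeries.HasSubst.X (S := k₀) (0 : Fin 2))).toRingHom

theorem inclX_X (k₀ : Type*) [Field k₀] : inclX k₀ PowerSeries.X = MvPowerSeries.X 0 :=
  PowerSeries.substAlgHom_X _

/-- For `K` over `k₀[[x, y]]`, with `A` the integral closure of `k₀[[x, y]]` in `K`,
this is the ring `A[x⁻¹]`. -/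
abbrev CoordRing (k₀ K : Type*) [Field k₀] [Field K] [Algebra (PS2 k₀) K] : Type _ :=
  Localization.Away
    (algebraMap (PS2 k₀) (integralClosure (PS2 k₀) K) (MvPowerSeries.X 0))

section CoordRing

variable (k₀ K L : Type*) [Field k₀] [Field K] [Field L] [Algebra (PS2 k₀) K]
  [Algebra (PS2 k₀) L]

theorem isUnit_algebraMap_inclX : IsUnit
    (((algebraMap (PS2 k₀) (CoordRing k₀ K)).comp (inclX k₀)) PowerSeries.X) := by
  rw [RingHom.comp_apply, inclX_X,
    IsScalarTower.algebraMap_apply (PS2 k₀) (integralClosure (PS2 k₀) K) (CoordRing k₀ K)]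
  exact IsLocalization.Away.algebraMap_isUnit _

/-- The ring map `k₀((x)) → A[x⁻¹]` extending `k₀[[x]] → k₀[[x, y]] → A[x⁻¹]`. -/
def structureMap : k₀⸨X⸩ →+* CoordRing k₀ K :=
  IsLocalization.Away.lift (S := k₀⸨X⸩) (PowerSeries.X : k₀⟦X⟧) (isUnit_algebraMap_inclX k₀ K)

/-- The `k₀((x))`-algebra structure of `A[x⁻¹]`. -/
instance coordRingAlgebra : Algebra k₀⸨X⸩ (CoordRing k₀ K) := (structureMap k₀ K).toAlgebra

variable [Algebra K L] [IsScalarTower (PS2 k₀) K L]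

/-- The inclusion `A → B` of the integral closures of `k₀[[x, y]]` in `K ⊆ L`. -/
def integralClosureMap :
    integralClosure (PS2 k₀) K →ₐ[PS2 k₀] integralClosure (PS2 k₀) L :=
  (IsScalarTower.toAlgHom (PS2 k₀) K L).mapIntegralClosure

theorem isUnit_integralClosureMap : IsUnit
    (((algebraMap (integralClosure (PS2 k₀) L) (CoordRing k₀ L)).comp
      (integralClosureMap k₀ K L).toRingHom)
        (algebraMap (PS2 k₀) (integralClosure (PS2 k₀) K) (MvPowerSeries.X 0))) := by
  have h : (integralClosureMap k₀ K L).toRingHom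
      (algebraMap (PS2 k₀) (integralClosure (PS2 k₀) K) (MvPowerSeries.X 0)) =
      algebraMap (PS2 k₀) (integralClosure (PS2 k₀) L) (MvPowerSeries.X 0) :=
    (integralClosureMap k₀ K L).commutes _
  rw [RingHom.comp_apply, h]
  exact IsLocalization.Away.algebraMap_isUnit _

/-- The ring map `A[x⁻¹] → B[x⁻¹]` induced by the inclusion `A → B`. -/
def coordRingHom : CoordRing k₀ K →+* CoordRing k₀ L :=
  IsLocalization.Away.lift _ (isUnit_integralClosureMap k₀ K L)

theorem coordRingHom_comp_structureMap :
    (coordRingHom k₀ K L).comp (structureMap k₀ K) = structureMap k₀ L := by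
  refine IsLocalization.ringHom_ext (Submonoid.powers (PowerSeries.X : k₀⟦X⟧)) ?_
  ext p
  simp only [RingHom.comp_apply, structureMap, IsLocalization.Away.lift_eq]
  rw [IsScalarTower.algebraMap_apply (PS2 k₀) (integralClosure (PS2 k₀) K) (CoordRing k₀ K),
    IsScalarTower.algebraMap_apply (PS2 k₀) (integralClosure (PS2 k₀) L) (CoordRing k₀ L),
    coordRingHom, IsLocalization.Away.lift_eq]
  exact congrArg (algebraMap (integralClosure (PS2 k₀) L) (CoordRing k₀ L))
    ((integralClosureMap k₀ K L).commutes (inclX k₀ p))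

/-- The map `A[x⁻¹] → B[x⁻¹]` as a map of `k₀((x))`-algebras; it is the comorphism of the
natural morphism `f : Spec B[x⁻¹] → Spec A[x⁻¹]` of `k₀((x))`-schemes. -/
def coordMap : CoordRing k₀ K →ₐ[k₀⸨X⸩] CoordRing k₀ L where
  __ := coordRingHom k₀ K L
  commutes' r := RingHom.congr_fun (coordRingHom_comp_structureMap k₀ K L) r

end CoordRing

/-- The morphism `Spec T → Spec S` given by `φ : S → T` is étale at the point `v`: its restriction
to some basic open neighbourhood `Spec T[1/g]` of `v` is étale. -/
def IsEtaleAtPoint {S T : Type*} [CommRing S] [CommRing T] (φ : S →+* T)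
    (v : PrimeSpectrum T) : Prop :=
  ∃ g : T, g ∉ v.asIdeal ∧ ((algebraMap T (Localization.Away g)).comp φ).Etale

section Points

variable (k S ℓ : Type*) [Field k] [CommRing S] [Algebra k S] [Field ℓ] [Algebra k ℓ]

/-- The set `X(ℓ)` of `ℓ`-points of the affine `k`-scheme `X = Spec S`: morphisms of `k`-schemes
`Spec ℓ → X`, that is, `k`-algebra maps `S → ℓ`. -/
def Points : Type _ := S →ₐ[k] ℓ

variable {k S ℓ}

/-- The function `g_* : X(ℓ) → ℓ` induced by a section `g` of the base change `X ⊗ ℓ`. -/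
def Points.eval (g : ℓ ⊗[k] S) (p : Points k S ℓ) : ℓ :=
  Algebra.TensorProduct.lift (Algebra.ofId ℓ ℓ) (show S →ₐ[k] ℓ from p)
    (fun _ _ => Commute.all _ _) g

/-- The topology of `X(ℓ)`: the coarsest one for which all functions `g_*` are continuous, where
`ℓ` has its topology as a `k`-module. For `ℓ` finite over a complete valued field `k`, the latter is
the unique Hausdorff topology that makes `ℓ` a topological `k`-vector space, and it is the topology
of the valuation of `ℓ`. -/
instance Points.topology [TopologicalSpace k] : TopologicalSpace (Points k S ℓ) :=
  ⨅ g : ℓ ⊗[k] S, TopologicalSpace.induced (Points.eval g) (moduleTopology k ℓ)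

/-- The map `f_ℓ : Y(ℓ) → X(ℓ)` induced by the morphism `f : Y = Spec T → X = Spec S` with
comorphism `φ`. -/
def Points.map {T : Type*} [CommRing T] [Algebra k T] (φ : S →ₐ[k] T) (p : Points k T ℓ) :
    Points k S ℓ :=
  (show T →ₐ[k] ℓ from p).comp φ

/-- The point `v` of `X = Spec S`, viewed as an element of `X(k(v))`: the canonical morphism
`Spec k(v) → X`. -/
def Points.ofPrime (k : Type*) {S : Type*} [Field k] [CommRing S] [Algebra k S]
    (v : PrimeSpectrum S) : Points k S v.asIdeal.ResidueField :=
  IsScalarTower.toAlgHom k S v.asIdeal.ResidueField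

end Points

end ImplicitFunction

end

/-
Étale maps are locally standard étale, `U = S[t]_g / (f)`. The `ℓ`-points of such a `U` form an open
subset of the space of pairs (point of `S`, root of the specialization of `f` at that point), namely
the one where `g` does not vanish. This root space is the base change, along the map that sends a
point to the coefficients of the specialized polynomial, of the universal map `(b, t) ↦ (b(t), b)`
on pairs of a polynomial and a scalar. The universal map is a local homeomorphism at simple roots by
the inverse function theorem over the complete field `ℓ`, and local homeomorphisms are stable under
base change.

That `k(v)` is finite over `k` is first proved for `k₀[[x, y]][x⁻¹]`: by Weierstrass preparation,
`k₀[[x]][[y]]/P` is finite over `k₀[[x]]` for every nonzero prime `P` that does not contain `x`. It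
follows that `D = k₀[[x, y]][x⁻¹]` is a Dedekind ring. The ring `B[x⁻¹]` is integral over `D`, and
elements of it that are linearly independent modulo a maximal ideal, over the residue field of `D`
below, are linearly independent over the fraction field of `D`; their number is therefore at most
the degree of `L` over `k₀((x, y))`.
-/

noncomputable section

namespace ImplicitFunction

section PointsTopology

variable {k S ℓ : Type*} [Field k] [CommRing S] [Algebra k S] [Field ℓ] [Algebra k ℓ]

instance : FunLike (Points k S ℓ) S ℓ := inferInstanceAs (FunLike (S →ₐ[k] ℓ) S ℓ)

instance : AlgHomClass (Points k S ℓ) k S ℓ := inferInstanceAs (AlgHomClass (S →ₐ[k] ℓ) k S ℓ)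

theorem Points.map_apply {T : Type*} [CommRing T] [Algebra k T] (φ : S →ₐ[k] T)
    (p : Points k T ℓ) (s : S) : p.map φ s = p (φ s) := rfl

theorem Points.eval_tmul (c : ℓ) (s : S) (p : Points k S ℓ) : p.eval (c ⊗ₜ[k] s) = c * p s := by
  simp only [Points.eval]
  rfl

theorem Points.range_map_of_isLocalization (g : S) (U : Type*) [CommRing U] [Algebra k U]
    [Algebra S U] [IsScalarTower k S U] [IsLocalization.Away g U] :
    Set.range (Points.map (IsScalarTower.toAlgHom k S U) : Points k U ℓ → Points k S ℓ) =
      {p | p g ≠ 0} := by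
  ext p
  constructor
  · rintro ⟨q, rfl⟩
    exact ((IsLocalization.Away.algebraMap_isUnit g).map q).ne_zero
  · intro hp
    have hunit : ∀ y : Submonoid.powers g, IsUnit ((show S →ₐ[k] ℓ from p) y) := by
      rintro ⟨_, n, rfl⟩
      rw [map_pow]
      exact (isUnit_iff_ne_zero.mpr hp).pow n
    exact ⟨IsLocalization.liftAlgHom hunit, DFunLike.ext _ _ fun s ↦ IsLocalization.lift_eq _ s⟩

variable [TopologicalSpace k] [TopologicalSpace ℓ] [IsModuleTopology k ℓ]

theorem Points.continuous_eval (g : ℓ ⊗[k] S) : Continuous (Points.eval (k := k) (S := S) g) := by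
  rw [continuous_iff_le_induced, eq_moduleTopology k ℓ]
  exact iInf_le _ g

theorem Points.continuous_apply (s : S) : Continuous fun p : Points k S ℓ ↦ p s :=
  (Points.continuous_eval ((1 : ℓ) ⊗ₜ[k] s)).congr fun p ↦ by rw [Points.eval_tmul, one_mul]

variable [IsTopologicalRing ℓ]

theorem Points.continuous_iff {Z : Type*} [TopologicalSpace Z] {r : Z → Points k S ℓ} :
    Continuous r ↔ ∀ s, Continuous fun z ↦ r z s := by
  refine ⟨fun h s ↦ (Points.continuous_apply s).comp h, fun h ↦ ?_⟩
  refine continuous_iInf_rng.mpr fun g ↦ continuous_induced_rng.mpr ?_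
  rw [← eq_moduleTopology k ℓ]
  induction g using TensorProduct.induction_on with
  | zero => exact continuous_const.congr fun z ↦ (map_zero _).symm
  | tmul c s => exact (continuous_const.mul (h s)).congr fun z ↦ (Points.eval_tmul c s (r z)).symm
  | add a b ha hb => exact (ha.add hb).congr fun z ↦ (map_add _ a b).symm

theorem Points.continuous_map {T : Type*} [CommRing T] [Algebra k T] (φ : S →ₐ[k] T) :
    Continuous (Points.map φ : Points k T ℓ → Points k S ℓ) :=
  Points.continuous_iff.mpr fun s ↦ Points.continuous_apply (φ s)

variable [ContinuousInv₀ ℓ]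

theorem Points.isInducing_of_forall_mul_eq {Y : Type*} [TopologicalSpace Y] {e : Points k S ℓ → Y}
    (he : Continuous e) (h : ∀ s, ∃ N D : Y → ℓ, Continuous N ∧ Continuous D ∧
      ∀ p, D (e p) ≠ 0 ∧ p s * D (e p) = N (e p)) :
    Topology.IsInducing e := by
  refine ⟨le_antisymm he.le_induced (continuous_id_iff_le.mp ?_)⟩
  refine (@Points.continuous_iff k S ℓ _ _ _ _ _ _ _ _ _ _ (.induced e ‹_›) _).mpr fun s ↦ ?_
  obtain ⟨N, D, hN, hD, h⟩ := h s
  let : TopologicalSpace (Points k S ℓ) := .induced e ‹_›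
  exact ((hN.comp continuous_induced_dom).div (hD.comp continuous_induced_dom)
    fun p ↦ (h p).1).congr fun p ↦ (eq_div_of_mul_eq (h p).1 (h p).2).symm

theorem Points.isOpenEmbedding_map_of_isLocalization [T1Space ℓ] (g : S) (U : Type*) [CommRing U]
    [Algebra k U] [Algebra S U] [IsScalarTower k S U] [IsLocalization.Away g U] :
    Topology.IsOpenEmbedding
      (Points.map (IsScalarTower.toAlgHom k S U) : Points k U ℓ → Points k S ℓ) := by
  refine ⟨⟨Points.isInducing_of_forall_mul_eq (Points.continuous_map _) fun u ↦ ?_, ?_⟩, ?_⟩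
  · obtain ⟨n, s, h⟩ := IsLocalization.Away.surj g u
    refine ⟨fun p ↦ p s, fun p ↦ p g ^ n, Points.continuous_apply s,
      (Points.continuous_apply g).pow n, fun p ↦ ⟨pow_ne_zero _ ?_, ?_⟩⟩
    · exact ((IsLocalization.Away.algebraMap_isUnit g).map p).ne_zero
    · simpa [Points.map_apply] using congrArg p h
  · intro p q hpq
    exact AlgHom.coe_ringHom_injective <| IsLocalization.ringHom_ext (Submonoid.powers g) <|
      RingHom.ext fun s ↦ DFunLike.congr_fun hpq s
  · rw [Points.range_map_of_isLocalization g]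
    exact isOpen_ne.preimage (Points.continuous_apply g)

theorem Points.isLocalHomeomorphOn_map_of_isLocalization [T1Space ℓ] {T : Type*} [CommRing T]
    [Algebra k T] [Algebra S T] [IsScalarTower k S T] (g : T) (U : Type*) [CommRing U] [Algebra k U]
    [Algebra S U] [IsScalarTower k S U] [Algebra T U] [IsScalarTower k T U] [IsScalarTower S T U]
    [IsLocalization.Away g U]
    (h : IsLocalHomeomorph
      (Points.map (IsScalarTower.toAlgHom k S U) : Points k U ℓ → Points k S ℓ)) :
    IsLocalHomeomorphOn
      (Points.map (IsScalarTower.toAlgHom k S T) : Points k T ℓ → Points k S ℓ) {p | p g ≠ 0} := by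
  have hj := (Points.isOpenEmbedding_map_of_isLocalization (k := k) (ℓ := ℓ) g U).isLocalHomeomorph
  have hcomp : (Points.map (IsScalarTower.toAlgHom k S U) : Points k U ℓ → Points k S ℓ) =
      Points.map (IsScalarTower.toAlgHom k S T) ∘ Points.map (IsScalarTower.toAlgHom k T U) :=
    funext fun p ↦ DFunLike.ext _ _ fun s ↦ congrArg p (IsScalarTower.algebraMap_apply S T U s)
  rw [← Points.range_map_of_isLocalization g U, ← Set.image_univ]
  exact (hcomp ▸ h).isLocalHomeomorphOn.of_comp_right hj.isLocalHomeomorphOn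

end PointsTopology

theorem isLocalHomeomorphOn_pullback_fst {X A B : Type*} [TopologicalSpace X] [TopologicalSpace A]
    [TopologicalSpace B] {f : X → B} (hf : Continuous f) {g : A → B} {s : Set A}
    (hg : IsLocalHomeomorphOn g s) :
    IsLocalHomeomorphOn (Function.Pullback.fst : f.Pullback g → X)
      (Function.Pullback.snd ⁻¹' s) := by
  classical
  rintro w hw
  obtain ⟨e, hwe, rfl⟩ := hg _ hw
  let lift (x : X) (hx : f x ∈ e.target) : f.Pullback e :=
    ⟨(x, e.symm (f x)), (e.right_inv hx).symm⟩
  refine ⟨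
    { toFun := Function.Pullback.fst
      invFun x := if hx : f x ∈ e.target then lift x hx else w
      source := Function.Pullback.snd ⁻¹' e.source
      target := f ⁻¹' e.target
      map_source' := ?_
      map_target' := ?_
      left_inv' := ?_
      right_inv' := ?_
      open_source := e.open_source.preimage (continuous_snd.comp continuous_subtype_val)
      open_target := e.open_target.preimage hf
      continuousOn_toFun := (continuous_fst.comp continuous_subtype_val).continuousOn
      continuousOn_invFun := ?_ }, hwe, rfl⟩
  · rintro ⟨⟨x, a⟩, h : f x = e a⟩ ha
    exact Set.mem_preimage.mpr (h ▸ e.map_source ha)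
  · intro x (hx : f x ∈ e.target)
    simp [hx, lift, Function.Pullback.snd]
  · rintro ⟨⟨x, a⟩, h : f x = e a⟩ (ha : a ∈ e.source)
    simp [h, ha, lift, Function.Pullback.fst]
  · intro x (hx : f x ∈ e.target)
    simp [hx, lift, Function.Pullback.fst]
  · refine Topology.IsInducing.subtypeVal.continuousOn_iff.mpr ?_
    refine (continuousOn_id.prodMk (e.continuousOn_symm.comp hf.continuousOn fun x hx ↦ hx)).congr
      fun x (hx : f x ∈ e.target) ↦ ?_
    simp [hx, lift]

section ImplicitRoot

variable {𝕜 : Type*} [NontriviallyNormedField 𝕜]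

theorem isLocalHomeomorphOn_prodMk_fst {E : Type*} [NormedAddCommGroup E] [NormedSpace 𝕜 E]
    [CompleteSpace E] [CompleteSpace 𝕜] {F : E × 𝕜 → 𝕜} {F' : E × 𝕜 →L[𝕜] 𝕜} {z : E × 𝕜} {d : 𝕜}
    (hF : HasStrictFDerivAt F F' z) (hd : HasDerivAt (fun t ↦ F (z.1, t)) d z.2) (hd0 : d ≠ 0) :
    IsLocalHomeomorphOn (fun w ↦ (F w, w.1)) {z} := by
  have hF' : F' ∘L .inr 𝕜 E 𝕜 = ContinuousLinearEquiv.unitsEquivAut 𝕜 (Units.mk0 d hd0) := by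
    ext
    simpa using (hF.hasFDerivAt.comp z.2 (hasFDerivAt_prodMk_right z.1 z.2)).hasDerivAt.unique hd
  rintro _ rfl
  exact ⟨_, (hF.implicitFunctionDataOfProdDomain
    ⟨_, hF'.symm⟩).pt_mem_toOpenPartialHomeomorph_source, rfl⟩

open Classical in
theorem isLocalHomeomorphOn_eval_ofFn [CompleteSpace 𝕜] (n : ℕ) :
    IsLocalHomeomorphOn (fun z : (Fin n → 𝕜) × 𝕜 ↦ ((Polynomial.ofFn n z.1).eval z.2, z.1))
      {z | (Polynomial.ofFn n z.1).derivative.eval z.2 ≠ 0} := by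
  intro z hz
  have h : AnalyticAt 𝕜 (fun z : (Fin n → 𝕜) × 𝕜 ↦ (Polynomial.ofFn n z.1).eval z.2) z := by
    simp only [Polynomial.ofFn_eq_sum_monomial, Polynomial.eval_finsetSum, Polynomial.eval_monomial]
    have hcoeff (i : Fin n) : AnalyticAt 𝕜 (fun z : (Fin n → 𝕜) × 𝕜 ↦ z.1 i) z :=
      (ContinuousLinearMap.proj i ∘L .fst 𝕜 (Fin n → 𝕜) 𝕜).analyticAt z
    exact Finset.univ.analyticAt_fun_sum fun i _ ↦ (hcoeff i).mul (analyticAt_snd.pow _)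
  exact isLocalHomeomorphOn_prodMk_fst h.hasStrictFDerivAt
    ((Polynomial.ofFn n z.1).hasDerivAt z.2) hz z rfl

end ImplicitRoot

section StandardEtale

variable {k S ℓ : Type*} [Field k] [CommRing S] [Algebra k S] [Field ℓ] [Algebra k ℓ]

/-- The polynomial over `ℓ` obtained from a polynomial `q` over `S`, seen as a family of
polynomials parametrized by `Spec S`, by evaluating its coefficients at an `ℓ`-point `φ`. -/
def Points.specialize (φ : Points k S ℓ) (q : Polynomial S) : Polynomial ℓ := q.map (φ : S →+* ℓ)

theorem Points.continuous_eval_specialize [TopologicalSpace k] [TopologicalSpace ℓ]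
    [IsModuleTopology k ℓ] [IsTopologicalRing ℓ] (q : Polynomial S) :
    Continuous fun z : Points k S ℓ × ℓ ↦ (z.1.specialize q).eval z.2 := by
  simp only [Points.specialize, Polynomial.eval_map, Polynomial.eval₂_eq_sum_range]
  exact continuous_finsetSum _ fun i _ ↦
    ((Points.continuous_apply _).comp continuous_fst).mul (continuous_snd.pow i)

open Classical in
/-- The coefficients of the polynomial obtained by specializing `f` at an `ℓ`-point, as a point of
the affine space of polynomials of degree at most that of `f`. -/
def Points.coeffVec (f : Polynomial S) (φ : Points k S ℓ) : Fin (f.natDegree + 1) → ℓ :=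
  Polynomial.toFn _ (φ.specialize f)

open Classical in
theorem Points.ofFn_coeffVec (f : Polynomial S) (φ : Points k S ℓ) :
    Polynomial.ofFn _ (φ.coeffVec f) = φ.specialize f :=
  Polynomial.ofFn_comp_toFn_eq_id_of_natDegree_lt
    (Nat.lt_succ_of_le Polynomial.natDegree_map_le)

theorem Points.continuous_coeffVec [TopologicalSpace k] [TopologicalSpace ℓ]
    [IsModuleTopology k ℓ] (f : Polynomial S) :
    Continuous (Points.coeffVec f : Points k S ℓ → _) :=
  continuous_pi fun i ↦
    (Points.continuous_apply (f.coeff i)).congr fun _ ↦ (Polynomial.coeff_map _ _).symm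

open Classical in
/-- The space of pairs of an `ℓ`-point `φ` of `S` and a root of `f` specialized at `φ`, realized as
the base change, along the coefficient vector of `f`, of the universal root
`(b, t) ↦ (b(t), b)` over its zero section. -/
abbrev RootSpace (k ℓ : Type*) [Field k] [Algebra k S] [Field ℓ] [Algebra k ℓ]
    (f : Polynomial S) : Type _ :=
  Function.Pullback (fun φ : Points k S ℓ ↦ ((0 : ℓ), φ.coeffVec f))
    (fun z : (Fin (f.natDegree + 1) → ℓ) × ℓ ↦ ((Polynomial.ofFn _ z.1).eval z.2, z.1))

namespace RootSpace

variable {f : Polynomial S}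

theorem coeffVec_fst (w : RootSpace k ℓ f) : w.fst.coeffVec f = w.snd.1 := congrArg Prod.snd w.2

/-- The underlying pair of a point and a root. -/
def toProd (w : RootSpace k ℓ f) : Points k S ℓ × ℓ := (w.fst, w.snd.2)

theorem toProd_injective : Function.Injective (toProd : RootSpace k ℓ f → Points k S ℓ × ℓ) := by
  intro v w h
  obtain ⟨hφ, ht⟩ := Prod.mk.inj h
  refine Subtype.ext (Prod.ext hφ (Prod.ext ?_ ht))
  exact (coeffVec_fst v).symm.trans ((congrArg _ hφ).trans (coeffVec_fst w))

theorem continuous_toProd [TopologicalSpace k] [TopologicalSpace ℓ] :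
    Continuous (toProd : RootSpace k ℓ f → Points k S ℓ × ℓ) :=
  (continuous_fst.prodMk continuous_snd.snd).comp continuous_subtype_val

theorem isLocalHomeomorphOn_fst {k ℓ : Type*} [Field k] [Algebra k S] [TopologicalSpace k]
    [NontriviallyNormedField ℓ] [CompleteSpace ℓ] [Algebra k ℓ] [IsModuleTopology k ℓ] :
    IsLocalHomeomorphOn (Function.Pullback.fst : RootSpace k ℓ f → Points k S ℓ)
      {w | (w.fst.specialize f).derivative.eval w.snd.2 ≠ 0} := by
  have hcont : Continuous fun φ : Points k S ℓ ↦ ((0 : ℓ), φ.coeffVec f) :=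
    continuous_const.prodMk (Points.continuous_coeffVec f)
  refine (isLocalHomeomorphOn_pullback_fst hcont (isLocalHomeomorphOn_eval_ofFn _)).mono
    fun w hw ↦ ?_
  rwa [Set.mem_preimage, Set.mem_ofPred_eq, ← coeffVec_fst, Points.ofFn_coeffVec]

end RootSpace

variable {U : Type*} [CommRing U] [Algebra k U] [Algebra S U] [IsScalarTower k S U]

theorem Points.apply_aeval (p : Points k U ℓ) (q : Polynomial S) (u : U) :
    p (Polynomial.aeval u q) =
      ((p.map (IsScalarTower.toAlgHom k S U)).specialize q).eval (p u) := by
  rw [Polynomial.aeval_def, ← RingHom.coe_coe, Polynomial.hom_eval₂, Points.specialize,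
    Polynomial.eval_map]
  rfl

variable (P : StandardEtalePresentation S U)

/-- A point of the standard étale algebra `U = S[x]_g / (f)`, as the pair of the point of `S` below
it and the value of the coordinate `x`. -/
def rootMap (p : Points k U ℓ) : Points k S ℓ × ℓ :=
  (p.map (IsScalarTower.toAlgHom k S U), p P.x)

theorem rootMap_injective : Function.Injective (rootMap P : Points k U ℓ → Points k S ℓ × ℓ) := by
  intro p q hpq
  obtain ⟨h, hx⟩ := Prod.mk.inj hpq
  let : Algebra S ℓ := (p.map (IsScalarTower.toAlgHom k S U) : S →+* ℓ).toAlgebra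
  let p' : U →ₐ[S] ℓ := { (p : U →+* ℓ) with commutes' _ := rfl }
  let q' : U →ₐ[S] ℓ := { (q : U →+* ℓ) with commutes' s := (DFunLike.congr_fun h s).symm }
  have : p' = q' := P.hom_ext hx
  exact DFunLike.ext _ _ fun u ↦ DFunLike.congr_fun this u

theorem range_rootMap : Set.range (rootMap P : Points k U ℓ → Points k S ℓ × ℓ) =
    {z | (z.1.specialize P.f).eval z.2 = 0 ∧ (z.1.specialize P.g).eval z.2 ≠ 0} := by
  ext ⟨φ, t⟩
  constructor
  · rintro ⟨p, hp⟩
    rw [← hp]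
    constructor
    · simp only [rootMap, ← Points.apply_aeval, P.hasMap.1, map_zero]
    · simp only [rootMap, ← Points.apply_aeval]
      exact (P.hasMap.2.map p).ne_zero
  · rintro ⟨hf, hg⟩
    let : Algebra S ℓ := (φ : S →+* ℓ).toAlgebra
    have : IsScalarTower k S ℓ :=
      IsScalarTower.of_algebraMap_eq fun c ↦ (AlgHomClass.commutes φ c).symm
    simp only [Points.specialize, Polynomial.eval_map] at hf hg
    have hroot : P.HasMap t := ⟨hf, hg.isUnit⟩
    let p : U →ₐ[S] ℓ := (P.lift t hroot).comp P.equivRing.toAlgHom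
    have hx : p P.x = t := (congrArg _ P.equivRing_x).trans (P.lift_X t hroot)
    exact ⟨p.restrictScalars k, Prod.ext (DFunLike.ext _ _ p.commutes) hx⟩

theorem continuous_rootMap [TopologicalSpace k] [TopologicalSpace ℓ]
    [IsModuleTopology k ℓ] [IsTopologicalRing ℓ] :
    Continuous (rootMap P : Points k U ℓ → Points k S ℓ × ℓ) :=
  (Points.continuous_map _).prodMk (Points.continuous_apply _)

theorem isInducing_rootMap [TopologicalSpace k] [TopologicalSpace ℓ] [IsModuleTopology k ℓ]
    [IsTopologicalRing ℓ] [ContinuousInv₀ ℓ] :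
    Topology.IsInducing (rootMap P : Points k U ℓ → Points k S ℓ × ℓ) := by
  refine Points.isInducing_of_forall_mul_eq (continuous_rootMap P) fun u ↦ ?_
  obtain ⟨q, m, h⟩ := P.exists_mul_aeval_x_g_pow_eq_aeval_x u
  refine ⟨_, _, Points.continuous_eval_specialize q,
    (Points.continuous_eval_specialize P.g).pow m, fun p ↦ ⟨pow_ne_zero m ?_, ?_⟩⟩
  · exact ((range_rootMap P).le ⟨p, rfl⟩).2
  · have hp := congrArg p h
    rwa [map_mul, map_pow, Points.apply_aeval, Points.apply_aeval] at hp

/-- The points of the standard étale algebra `U = S[x]_g / (f)`, mapped to the root space of `f` by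
`rootMap`. -/
def toRootSpace (p : Points k U ℓ) : RootSpace k ℓ P.f :=
  ⟨((rootMap P p).1, (rootMap P p).1.coeffVec P.f, (rootMap P p).2), by
    simp only [Points.ofFn_coeffVec, ((range_rootMap P).le ⟨p, rfl⟩).1]⟩

theorem range_toRootSpace : Set.range (toRootSpace P : Points k U ℓ → RootSpace k ℓ P.f) =
    {w | (w.fst.specialize P.g).eval w.snd.2 ≠ 0} := by
  ext w
  constructor
  · rintro ⟨p, rfl⟩
    exact ((range_rootMap P).le ⟨p, rfl⟩).2
  · intro hg
    have hf : (w.fst.specialize P.f).eval w.snd.2 = 0 := by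
      rw [← Points.ofFn_coeffVec, RootSpace.coeffVec_fst]
      exact (congrArg Prod.fst w.2).symm
    obtain ⟨p, hp⟩ := (range_rootMap P).ge (show w.toProd ∈ _ from ⟨hf, hg⟩)
    exact ⟨p, RootSpace.toProd_injective hp⟩

theorem isOpenEmbedding_toRootSpace [TopologicalSpace k] [TopologicalSpace ℓ] [T1Space ℓ]
    [IsModuleTopology k ℓ] [IsTopologicalRing ℓ] [ContinuousInv₀ ℓ] :
    Topology.IsOpenEmbedding (toRootSpace P : Points k U ℓ → RootSpace k ℓ P.f) := by
  have hroot := continuous_rootMap P (k := k) (ℓ := ℓ)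
  have hcont : Continuous (toRootSpace P : Points k U ℓ → RootSpace k ℓ P.f) :=
    (hroot.fst.prodMk (((Points.continuous_coeffVec P.f).comp hroot.fst).prodMk
      hroot.snd)).subtype_mk _
  refine ⟨⟨.of_comp hcont RootSpace.continuous_toProd (isInducing_rootMap P),
    .of_comp (f := RootSpace.toProd) (rootMap_injective P)⟩, ?_⟩
  rw [range_toRootSpace]
  exact isOpen_ne.preimage
    ((Points.continuous_eval_specialize P.g).comp RootSpace.continuous_toProd)

end StandardEtale

section Etale

variable {k S ℓ : Type*} [Field k] [TopologicalSpace k] [CommRing S] [Algebra k S]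
  [NontriviallyNormedField ℓ] [CompleteSpace ℓ] [Algebra k ℓ] [IsModuleTopology k ℓ]

theorem isLocalHomeomorph_map_of_isStandardEtale (U : Type*) [CommRing U] [Algebra k U]
    [Algebra S U] [IsScalarTower k S U] [Algebra.IsStandardEtale S U] :
    IsLocalHomeomorph
      (Points.map (IsScalarTower.toAlgHom k S U) : Points k U ℓ → Points k S ℓ) := by
  obtain ⟨P⟩ := Algebra.IsStandardEtale.nonempty_standardEtalePresentation (R := S) (S := U)
  rw [isLocalHomeomorph_iff_isLocalHomeomorphOn_univ]
  refine (RootSpace.isLocalHomeomorphOn_fst (f := P.f)).comp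
    (isOpenEmbedding_toRootSpace P).isLocalHomeomorph.isLocalHomeomorphOn fun p _ ↦ ?_
  have h : p (Polynomial.aeval P.x P.f.derivative) ≠ 0 :=
    (P.hasMap.isUnit_derivative_f.map p).ne_zero
  rw [Points.apply_aeval, Points.specialize, ← Polynomial.derivative_map] at h
  exact h

theorem isLocalHomeomorph_map_of_etale (U : Type*) [CommRing U] [Algebra k U]
    [Algebra S U] [IsScalarTower k S U] [Algebra.Etale S U] :
    IsLocalHomeomorph
      (Points.map (IsScalarTower.toAlgHom k S U) : Points k U ℓ → Points k S ℓ) := by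
  intro q
  have hq : (RingHom.ker q).IsPrime := RingHom.ker_isPrime q
  obtain ⟨g, hg, hstd⟩ := Algebra.IsEtaleAt.exists_isStandardEtale (R := S) (RingHom.ker q)
  exact Points.isLocalHomeomorphOn_map_of_isLocalization g _
    (isLocalHomeomorph_map_of_isStandardEtale (Localization.Away g)) q hg

theorem isLocalHomeomorphOn_map_of_isEtaleAtPoint {T : Type*} [CommRing T] [Algebra k T]
    (φ : S →ₐ[k] T) {v : PrimeSpectrum T} (hφ : IsEtaleAtPoint (φ : S →+* T) v) :
    IsLocalHomeomorphOn (Points.map φ : Points k T ℓ → Points k S ℓ)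
      {p | RingHom.ker p = v.asIdeal} := by
  obtain ⟨g, hg, hetale⟩ := hφ
  let : Algebra S T := (φ : S →+* T).toAlgebra
  have : IsScalarTower k S T := IsScalarTower.of_algebraMap_eq fun c ↦ (φ.commutes c).symm
  have : Algebra.Etale S (Localization.Away g) := by
    rwa [← RingHom.etale_algebraMap, IsScalarTower.algebraMap_eq S T]
  refine (Points.isLocalHomeomorphOn_map_of_isLocalization g _
    (isLocalHomeomorph_map_of_etale (Localization.Away g))).mono fun p hp ↦ ?_
  rwa [← hp] at hg

end Etale

section WeierstrassQuotient

open PowerSeries (C)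

variable {O : Type*} [CommRing O]

theorem C_dvd_of_map_residue_eq_zero [IsLocalRing O] {ϖ : O}
    (hϖ : IsLocalRing.maximalIdeal O = Ideal.span {ϖ}) {F : O⟦X⟧}
    (hF : F.map (IsLocalRing.residue O) = 0) : C ϖ ∣ F := by
  have hcoeff (i : ℕ) : ϖ ∣ PowerSeries.coeff i F := by
    rw [← Ideal.mem_span_singleton, ← hϖ, ← IsLocalRing.residue_eq_zero_iff,
      ← PowerSeries.coeff_map, hF, map_zero]
  choose c hc using hcoeff
  exact ⟨.mk c, PowerSeries.ext fun i ↦ by rw [PowerSeries.coeff_C_mul, PowerSeries.coeff_mk, hc]⟩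

theorem finite_quotient_span_singleton [IsLocalRing O]
    [IsAdicComplete (IsLocalRing.maximalIdeal O) O]
    {F : O⟦X⟧} (hF : F.map (IsLocalRing.residue O) ≠ 0) :
    Module.Finite O (O⟦X⟧ ⧸ Ideal.span {F}) := by
  obtain ⟨f, u, H⟩ := PowerSeries.exists_isWeierstrassFactorization hF
  have := H.isDistinguishedAt.monic.finite_quotient
  exact .equiv (PowerSeries.IsWeierstrassFactorizationAt.algEquivQuotient H).toLinearEquiv

variable [IsDomain O] [IsDiscreteValuationRing O]

theorem exists_mem_map_residue_ne_zero {ϖ : O} (hϖ : Irreducible ϖ) {P : Ideal O⟦X⟧} [P.IsPrime]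
    (hP : P ≠ ⊥) (hϖP : C ϖ ∉ P) : ∃ F ∈ P, F.map (IsLocalRing.residue O) ≠ 0 := by
  obtain ⟨q, hqP, hq⟩ := Ideal.IsPrime.exists_mem_prime_of_ne_bot ‹P.IsPrime› hP
  refine ⟨q, hqP, fun h ↦ ?_⟩
  obtain ⟨c, rfl⟩ := C_dvd_of_map_residue_eq_zero hϖ.maximalIdeal_eq h
  have hcP : c ∈ P := (Ideal.IsPrime.mem_or_mem ‹_› hqP).resolve_left hϖP
  have hϖunit : ¬ IsUnit (C ϖ) := fun h ↦ hϖ.not_isUnit <| by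
    simpa only [PowerSeries.constantCoeff_C] using h.map (PowerSeries.constantCoeff (R := O))
  exact Ideal.IsPrime.ne_top ‹_› <|
    Ideal.eq_top_of_isUnit_mem _ hcP ((hq.irreducible.isUnit_or_isUnit rfl).resolve_left hϖunit)

variable [IsAdicComplete (IsLocalRing.maximalIdeal O) O] {ϖ : O} (hϖ : Irreducible ϖ)

include hϖ in
theorem finite_quotient_of_C_notMem {P : Ideal O⟦X⟧} [P.IsPrime] (hP : P ≠ ⊥) (hϖP : C ϖ ∉ P) :
    Module.Finite O (O⟦X⟧ ⧸ P) := by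
  obtain ⟨F, hFP, hF⟩ := exists_mem_map_residue_ne_zero hϖ hP hϖP
  have := finite_quotient_span_singleton hF
  have hle : Ideal.span {F} ≤ P := (Ideal.span_singleton_le_iff_mem P).mpr hFP
  exact .of_surjective (Ideal.Quotient.factorₐ O hle).toLinearMap
    (Ideal.Quotient.factor_surjective hle)

end WeierstrassQuotient

section LocalizedPowerSeries

open PowerSeries (C)

variable {O : Type*} [CommRing O] [IsDomain O]

theorem powers_C_le_nonZeroDivisors {ϖ : O} (hϖ : ϖ ≠ 0) :
    Submonoid.powers (C ϖ) ≤ nonZeroDivisors O⟦X⟧ :=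
  powers_le_nonZeroDivisors_of_noZeroDivisors <|
    (map_ne_zero_iff _ PowerSeries.C_injective).mpr hϖ

theorem not_isField_of_isLocalizationAway_C {ϖ : O} (hϖ : ϖ ≠ 0) (S : Type*) [CommRing S]
    [Algebra O⟦X⟧ S] [IsLocalization.Away (C ϖ) S] : ¬ IsField S := by
  intro hS
  have hinj : Function.Injective (algebraMap O⟦X⟧ S) :=
    IsLocalization.injective S (powers_C_le_nonZeroDivisors hϖ)
  obtain ⟨s, hs⟩ := hS.mul_inv_cancel (a := algebraMap O⟦X⟧ S PowerSeries.X)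
    ((map_ne_zero_iff _ hinj).mpr PowerSeries.X_ne_zero)
  obtain ⟨n, F, hF⟩ := IsLocalization.Away.surj (C ϖ) s
  have hXF : PowerSeries.X * F = C ϖ ^ n := hinj <| by
    rw [map_mul, ← hF, ← mul_assoc, hs, one_mul, map_pow]
  have h0 := congrArg (PowerSeries.constantCoeff (R := O)) hXF
  simp only [map_mul, map_pow, PowerSeries.constantCoeff_X, zero_mul,
    PowerSeries.constantCoeff_C] at h0
  exact pow_ne_zero n hϖ h0.symm

variable [IsDiscreteValuationRing O] [IsAdicComplete (IsLocalRing.maximalIdeal O) O] {ϖ : O}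
  (hϖ : Irreducible ϖ) (k : Type*) [Field k] [Algebra O k] [IsFractionRing O k] {S : Type*}
  [CommRing S] [Algebra O⟦X⟧ S] [IsLocalization.Away (C ϖ) S] [Algebra O S]
  [IsScalarTower O O⟦X⟧ S] [Algebra k S] [IsScalarTower O k S]

include hϖ

theorem finite_quotient_of_isLocalizationAway_C {Q : Ideal S} [Q.IsPrime] (hQ : Q ≠ ⊥) :
    Module.Finite k (S ⧸ Q) := by
  let P := Q.under O⟦X⟧
  have hP : P ≠ ⊥ := (IsLocalization.bot_lt_under_prime (Submonoid.powers (C ϖ)) S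
    (powers_C_le_nonZeroDivisors hϖ.ne_zero) Q hQ).ne'
  have hϖP : C ϖ ∉ P := fun h ↦ Ideal.IsPrime.ne_top ‹Q.IsPrime› <|
    Ideal.eq_top_of_isUnit_mem _ h (IsLocalization.Away.algebraMap_isUnit (C ϖ))
  have := finite_quotient_of_C_notMem hϖ hP hϖP
  let f : (O⟦X⟧ ⧸ P) →ₗ[O] S ⧸ Q :=
    (Ideal.quotientMapₐ Q (IsScalarTower.toAlgHom O O⟦X⟧ S) le_rfl).toLinearMap
  refine .of_surjective (f.liftBaseChange k) fun y ↦ ?_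
  obtain ⟨s, rfl⟩ := Ideal.Quotient.mk_surjective y
  obtain ⟨n, F, hF⟩ := IsLocalization.Away.surj (C ϖ) s
  have hs : ϖ ^ n • s = algebraMap O⟦X⟧ S F := by
    rw [← hF, Algebra.smul_def, mul_comm, map_pow, IsScalarTower.algebraMap_apply O O⟦X⟧ S]
    rfl
  have hϖk : algebraMap O k (ϖ ^ n) ≠ 0 :=
    (map_ne_zero_iff _ (IsFractionRing.injective O k)).mpr (pow_ne_zero n hϖ.ne_zero)
  refine ⟨(algebraMap O k (ϖ ^ n))⁻¹ ⊗ₜ Ideal.Quotient.mk P F, ?_⟩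
  rw [LinearMap.liftBaseChange_tmul, inv_smul_eq_iff₀ hϖk, algebraMap_smul]
  exact congrArg (Ideal.Quotient.mk Q) hs.symm

include k in
theorem isDedekindDomain_of_isLocalizationAway_C : IsDedekindDomain S := by
  have hle := powers_C_le_nonZeroDivisors hϖ.ne_zero
  have := IsLocalization.isDomain_of_le_nonZeroDivisors S hle
  have := IsLocalization.isNoetherianRing (Submonoid.powers (C ϖ)) S inferInstance
  have := isIntegrallyClosed_of_isLocalization S (Submonoid.powers (C ϖ)) hle
  have : Ring.DimensionLEOne S := ⟨fun {Q} hQ _ ↦ by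
    have := finite_quotient_of_isLocalizationAway_C hϖ k hQ
    exact Ideal.Quotient.maximal_of_isField Q
      (isField_of_isIntegral_of_isField' (Field.toIsField k))⟩
  exact { }

end LocalizedPowerSeries

section IntegralOverDedekind

variable {D F : Type*} [CommRing D] [IsDedekindDomain D] [Field F] [Algebra D F]
  [IsFractionRing D F]

section LinearMap

variable {κ M V W : Type*} [Field κ] [Algebra D κ] [AddCommGroup M] [Module D M] [AddCommGroup V]
  [Module D V] [Module F V] [IsScalarTower D F V] [AddCommGroup W] [Module D W] [Module κ W]
  [IsScalarTower D κ W] {f : M →ₗ[D] V} (hf : Function.Injective f) {g : M →ₗ[D] W}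

include hf

variable (F) in
theorem linearIndependent_comp_of_injective {ι : Type*} {b : ι → M}
    (hb : LinearIndependent κ (g ∘ b)) : LinearIndependent F (f ∘ b) := by
  rw [linearIndependent_iff'] at hb ⊢
  intro s c hc
  by_contra! hc₀
  obtain ⟨i, his, hi⟩ := hc₀
  -- Scale the relation so that its coefficients lie in `D` but do not all vanish in `κ`.
  obtain ⟨a, ha, j, hjs, hj⟩ := Ideal.exist_integer_multiples_notMem
    (RingHom.ker_ne_top (algebraMap D κ)) s c his hi
  choose! d hd using ha
  have hdb : ∑ i ∈ s, d i • b i = 0 := hf <| by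
    rw [map_sum, map_zero, ← smul_zero a, ← hc, Finset.smul_sum]
    refine Finset.sum_congr rfl fun i his ↦ ?_
    rw [map_smul, ← algebraMap_smul F, hd i his, mul_smul, Function.comp_apply]
  have hgd : ∑ i ∈ s, algebraMap D κ (d i) • (g ∘ b) i = 0 := by
    simp only [algebraMap_smul, Function.comp_apply, ← map_smul, ← map_sum, hdb, map_zero]
  exact hj (hd j hjs ▸ FractionalIdeal.mem_coeIdeal_of_mem _ (hb s _ hgd j hjs))

variable (F κ) in
theorem finite_of_injective_of_surjective [Module.Finite F V] (hg : Function.Surjective g) :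
    Module.Finite κ W := by
  rw [← Module.rank_lt_aleph0_iff]
  refine (rank_le (n := Module.finrank F V) fun s hs ↦ ?_).trans_lt Cardinal.natCast_lt_aleph0
  have hgs : g ∘ Function.surjInv hg ∘ ((↑) : s → W) = (↑) :=
    funext fun w ↦ Function.surjInv_eq hg _
  have := linearIndependent_comp_of_injective F hf (b := Function.surjInv hg ∘ ((↑) : s → W))
    (hgs ▸ hs)
  simpa only [Fintype.card_coe] using this.fintype_card_le_finrank

end LinearMap

variable (D F) (k : Type*) [Field k] [Algebra k D] {T : Type*} [CommRing T] [Algebra D T]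
  [Algebra.IsIntegral D T] [Algebra k T] [IsScalarTower k D T]

theorem finite_quotient_of_isIntegral (E : Type*) [Field E] [Algebra D E] [Algebra F E]
    [IsScalarTower D F E] [FiniteDimensional F E] [Algebra T E] [IsScalarTower D T E]
    (hTE : Function.Injective (algebraMap T E)) (hD : ¬ IsField D)
    (hfin : ∀ Q : Ideal D, Q.IsPrime → Q ≠ ⊥ → Module.Finite k (D ⧸ Q)) (m : Ideal T)
    [m.IsMaximal] : Module.Finite k (T ⧸ m) := by
  have hm : (m.under D).IsMaximal := Ideal.isMaximal_comap_of_isIntegral_of_isMaximal m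
  have := hfin _ hm.isPrime (Ring.ne_bot_of_isMaximal_of_not_isField hm hD)
  let := Ideal.Quotient.field (m.under D)
  have : Module.Finite (D ⧸ m.under D) (T ⧸ m) :=
    finite_of_injective_of_surjective F (D ⧸ m.under D)
      (f := (IsScalarTower.toAlgHom D T E).toLinearMap) hTE
      (g := (Ideal.Quotient.mkₐ D m).toLinearMap) Ideal.Quotient.mk_surjective
  exact .trans (D ⧸ m.under D) _

end IntegralOverDedekind

section LocalizedIntegralClosure

variable {R F E S T : Type*} [CommRing R] [Field F] [Algebra R F] [IsFractionRing R F] [Field E]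
  [Algebra R E] [Algebra F E] [IsScalarTower R F E] [CommRing S] [Algebra R S] [CommRing T]
  [Algebra R T] [Algebra (integralClosure R E) T] [IsScalarTower R (integralClosure R E) T] {x : R}

theorem isIntegral_of_isLocalizationAway {B : Type*} [CommRing B] [Algebra R B]
    [Algebra.IsIntegral R B] [Algebra B T] [IsScalarTower R B T]
    [IsLocalization.Away (algebraMap R B x) T] [Algebra S T] [IsScalarTower R S T]
    (hx : IsUnit (algebraMap R S x)) : Algebra.IsIntegral S T where
  isIntegral t := by
    obtain ⟨n, b, hb⟩ := IsLocalization.Away.surj (algebraMap R B x) t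
    obtain ⟨u, hu⟩ := isUnit_iff_exists_inv'.mp hx
    have hbT : IsIntegral S (algebraMap B T b) :=
      ((Algebra.IsIntegral.isIntegral (R := R) b).algebraMap).tower_top
    have hxu : algebraMap S T (u ^ n) * algebraMap B T (algebraMap R B x) ^ n = 1 := by
      rw [← IsScalarTower.algebraMap_apply, IsScalarTower.algebraMap_apply R S T, ← map_pow,
        ← map_mul, ← mul_pow, hu, one_pow, map_one]
    exact .of_mul_unit hxu (hb ▸ hbT)

variable (F) in
theorem finite_quotient_of_isLocalizationAway [FiniteDimensional F E] [IsDedekindDomain S]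
    [IsLocalization.Away x S] [IsLocalization.Away (algebraMap R (integralClosure R E) x) T]
    (hx : x ≠ 0) (k : Type*) [Field k] [Algebra k S] [Algebra k T] (φ : S →ₐ[k] T)
    (hφ : ∀ r, φ (algebraMap R S r) = algebraMap R T r) (hS : ¬ IsField S)
    (hfin : ∀ Q : Ideal S, Q.IsPrime → Q ≠ ⊥ → Module.Finite k (S ⧸ Q)) (m : Ideal T)
    [m.IsMaximal] : Module.Finite k (T ⧸ m) := by
  let B := integralClosure R E
  let : Algebra S T := φ.toRingHom.toAlgebra
  have : IsScalarTower k S T := .of_algebraMap_eq fun c ↦ (φ.commutes c).symm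
  have : IsScalarTower R S T := .of_algebraMap_eq fun r ↦ (hφ r).symm
  have : IsDomain R := (IsFractionRing.injective R F).isDomain
  have : IsFractionRing B E := integralClosure.isFractionRing_of_finite_extension F E
  have hxE : algebraMap R E x ≠ 0 := by
    rw [IsScalarTower.algebraMap_apply R F E]
    exact (map_ne_zero _).mpr ((map_ne_zero_iff _ (IsFractionRing.injective R F)).mpr hx)
  have hxB : algebraMap R B x ≠ 0 := fun h ↦ hxE (congrArg Subtype.val h)
  have hR := powers_le_nonZeroDivisors_of_noZeroDivisors hx
  have hB := powers_le_nonZeroDivisors_of_noZeroDivisors hxB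
  let : Algebra S F := IsLocalization.localizationAlgebraOfSubmonoidLe S F _ _ hR
  let : Algebra T E := IsLocalization.localizationAlgebraOfSubmonoidLe T E _ _ hB
  have : IsScalarTower R S F :=
    IsLocalization.localization_isScalarTower_of_submonoid_le S F _ _ hR
  have : IsScalarTower B T E :=
    IsLocalization.localization_isScalarTower_of_submonoid_le T E _ _ hB
  have : IsScalarTower R T E := .to₁₃₄ R B T E
  have : IsFractionRing S F :=
    IsFractionRing.isFractionRing_of_isDomain_of_isLocalization (Submonoid.powers x) S F
  have : IsFractionRing T E := IsFractionRing.isFractionRing_of_isDomain_of_isLocalization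
    (Submonoid.powers (algebraMap R B x)) T E
  let : Algebra S E := ((algebraMap F E).comp (algebraMap S F)).toAlgebra
  have : IsScalarTower S F E := .of_algebraMap_eq' rfl
  have : IsScalarTower S T E := .of_algebraMap_eq' <|
    IsLocalization.ringHom_ext (Submonoid.powers x) <| by
      rw [IsScalarTower.algebraMap_eq S F E, RingHom.comp_assoc, RingHom.comp_assoc,
        ← IsScalarTower.algebraMap_eq R S F, ← IsScalarTower.algebraMap_eq R S T,
        ← IsScalarTower.algebraMap_eq R F E, ← IsScalarTower.algebraMap_eq R T E]
  have : Algebra.IsIntegral S T :=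
    isIntegral_of_isLocalizationAway (B := B) (IsLocalization.Away.algebraMap_isUnit x)
  exact finite_quotient_of_isIntegral S F k E (IsFractionRing.injective T E) hS hfin m

end LocalizedIntegralClosure

section TwoVariables

variable (k₀ : Type*) [Field k₀]

instance isAdicComplete_powerSeries : IsAdicComplete (IsLocalRing.maximalIdeal k₀⟦X⟧) k₀⟦X⟧ := by
  rw [PowerSeries.maximalIdeal_eq_span_X]
  infer_instance

/-- The bijection of `{0, 1}` with `Option Unit` that sends `1` to `none`. -/
def finTwoEquivOption : Fin 2 ≃ Option Unit where
  toFun i := if i = 0 then some () else none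
  invFun o := o.elim 1 fun _ ↦ 0
  left_inv i := by fin_cases i <;> rfl
  right_inv o := by rcases o with _ | ⟨⟩ <;> rfl

/-- The isomorphism `k₀[[x, y]] ≃ k₀[[x]][[y]]`. -/
def iteratedEquiv : PS2 k₀ ≃ₐ[k₀] k₀⟦X⟧⟦X⟧ :=
  (MvPowerSeries.renameEquiv k₀ finTwoEquivOption).trans (MvPowerSeries.optionEquivLeft Unit k₀)

theorem optionEquivLeft_rename_some (f : k₀⟦X⟧) :
    MvPowerSeries.optionEquivLeft Unit k₀
      (MvPowerSeries.rename (Function.Embedding.some : Unit ↪ Option Unit) f) =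
      PowerSeries.C f := by
  refine PowerSeries.ext fun n ↦ MvPowerSeries.ext fun m ↦ ?_
  rw [MvPowerSeries.coeff_coeff_optionEquivLeft]
  rcases Nat.eq_zero_or_pos n with rfl | hn
  · have hm : m.optionElim 0 = m.embDomain Function.Embedding.some := by
      ext o
      rcases o with _ | u
      · rw [Finsupp.embDomain_of_notMem_range _ _ _ (by simp), Finsupp.optionElim_apply_none]
      · rw [Finsupp.optionElim_apply_some]
        exact (Finsupp.embDomain_apply_self Function.Embedding.some m u).symm
    rw [hm, MvPowerSeries.coeff_embDomain_rename, PowerSeries.coeff_zero_C]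
  · rw [PowerSeries.coeff_C, if_neg hn.ne', map_zero]
    refine MvPowerSeries.coeff_rename_eq_zero _ _ ?_
    rintro ⟨a, ha⟩
    have h0 := DFunLike.congr_fun ha none
    rw [Finsupp.mapDomain_of_notMem_range _ _ (by simp), Finsupp.optionElim_apply_none] at h0
    exact hn.ne h0

theorem iteratedEquiv_inclX (f : k₀⟦X⟧) : iteratedEquiv k₀ (inclX k₀ f) = PowerSeries.C f := by
  have hrename : inclX k₀ f = MvPowerSeries.rename (fun _ : Unit ↦ (0 : Fin 2)) f := by
    rw [MvPowerSeries.rename_eq_subst]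
    exact congrFun (PowerSeries.coe_substAlgHom _) f
  rw [← optionEquivLeft_rename_some, hrename]
  change MvPowerSeries.optionEquivLeft Unit k₀ (MvPowerSeries.rename finTwoEquivOption _) = _
  rw [MvPowerSeries.rename_rename]
  rfl

instance : IsIntegrallyClosed (PS2 k₀) :=
  have : IsIntegrallyClosed k₀⟦X⟧⟦X⟧ := inferInstance
  .of_equiv (iteratedEquiv k₀).symm.toRingEquiv

end TwoVariables

section CoordRing

variable (k₀ K L : Type*) [Field k₀] [Field K] [Algebra (PS2 k₀) K] [Field L] [Algebra (PS2 k₀) L]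

-- For `R = k₀⟦X⟧`, instance search would give `R⟦X⟧` the coefficientwise `k₀⟦X⟧`-algebra structure
-- instead of the one by constants; a general `R` avoids this.
theorem isScalarTower_of_algebraMap_C {R S : Type*} [CommRing R] [CommRing S] [Algebra R S]
    [Algebra R⟦X⟧ S] (h : ∀ r : R, algebraMap R S r = algebraMap R⟦X⟧ S (PowerSeries.C r)) :
    IsScalarTower R R⟦X⟧ S :=
  .of_algebraMap_eq h

/-- The structure of `A[x⁻¹]` as an algebra over `k₀[[x]] ⊆ k₀[[x, y]]`. -/
instance powerSeriesAlgebra : Algebra k₀⟦X⟧ (CoordRing k₀ K) :=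
  ((algebraMap (PS2 k₀) (CoordRing k₀ K)).comp (inclX k₀)).toAlgebra

/-- The structure of `A[x⁻¹]` as an algebra over `k₀[[x]][[y]] ≃ k₀[[x, y]]`. -/
instance iteratedAlgebra : Algebra k₀⟦X⟧⟦X⟧ (CoordRing k₀ K) :=
  ((algebraMap (PS2 k₀) (CoordRing k₀ K)).comp (iteratedEquiv k₀).symm.toRingHom).toAlgebra

instance : IsScalarTower k₀⟦X⟧ k₀⸨X⸩ (CoordRing k₀ K) :=
  .of_algebraMap_eq fun f ↦
    (IsLocalization.Away.lift_eq PowerSeries.X (isUnit_algebraMap_inclX k₀ K) f).symm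

theorem algebraMap_powerSeries_eq_algebraMap_C (f : k₀⟦X⟧) :
    algebraMap k₀⟦X⟧ (CoordRing k₀ K) f =
      algebraMap k₀⟦X⟧⟦X⟧ (CoordRing k₀ K) (PowerSeries.C f) := by
  rw [← iteratedEquiv_inclX]
  exact congrArg (algebraMap (PS2 k₀) (CoordRing k₀ K))
    ((iteratedEquiv k₀).symm_apply_apply (inclX k₀ f)).symm

instance : IsLocalization.Away (MvPowerSeries.X 0 : PS2 k₀) (CoordRing k₀ (LS2 k₀)) := by
  let e : PS2 k₀ ≃ₐ[PS2 k₀] integralClosure (PS2 k₀) (LS2 k₀) :=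
    IsIntegralClosure.equiv (PS2 k₀) (PS2 k₀) (LS2 k₀) _
  refine IsLocalization.of_ringEquiv_left e.toRingEquiv
    (M₁ := .powers (algebraMap (PS2 k₀) _ (MvPowerSeries.X 0))) ?_ fun F ↦ ?_
  · rw [Submonoid.map_powers]
    exact congrArg _ (e.commutes _)
  · rw [IsScalarTower.algebraMap_apply (PS2 k₀) (integralClosure (PS2 k₀) (LS2 k₀))
      (CoordRing k₀ (LS2 k₀))]
    exact congrArg (algebraMap _ (CoordRing k₀ (LS2 k₀))) (e.commutes F).symm

instance : IsLocalization.Away (PowerSeries.C (PowerSeries.X : k₀⟦X⟧))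
    (CoordRing k₀ (LS2 k₀)) := by
  refine IsLocalization.of_ringEquiv_left (iteratedEquiv k₀).symm.toRingEquiv
    (M₁ := .powers (MvPowerSeries.X 0)) ?_ fun F ↦ rfl
  rw [Submonoid.map_powers, ← inclX_X, ← iteratedEquiv_inclX]
  exact congrArg _ ((iteratedEquiv k₀).symm_apply_apply _)

variable [Algebra K L] [IsScalarTower (PS2 k₀) K L]

theorem coordMap_algebraMap (p : PS2 k₀) :
    coordMap k₀ K L (algebraMap (PS2 k₀) (CoordRing k₀ K) p) = algebraMap (PS2 k₀) _ p :=
  (IsLocalization.Away.lift_eq _ (isUnit_integralClosureMap k₀ K L) _).trans <|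
    congrArg (algebraMap _ (CoordRing k₀ L)) ((integralClosureMap k₀ K L).commutes p)

variable [Algebra (LS2 k₀) L] [IsScalarTower (PS2 k₀) (LS2 k₀) L] [FiniteDimensional (LS2 k₀) L]

variable {L}

theorem finite_quotient_coordRing (m : Ideal (CoordRing k₀ L)) [hm : m.IsMaximal] :
    Module.Finite k₀⸨X⸩ (CoordRing k₀ L ⧸ m) := by
  have hX : Irreducible (PowerSeries.X : k₀⟦X⟧) := PowerSeries.X_prime.irreducible
  have := isScalarTower_of_algebraMap_C (algebraMap_powerSeries_eq_algebraMap_C k₀ (LS2 k₀))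
  have := isDedekindDomain_of_isLocalizationAway_C hX k₀⸨X⸩ (S := CoordRing k₀ (LS2 k₀))
  exact finite_quotient_of_isLocalizationAway (LS2 k₀) (E := L) (S := CoordRing k₀ (LS2 k₀))
    (x := MvPowerSeries.X 0) (nonZeroDivisors.ne_zero MvPowerSeries.X_mem_nonzeroDivisors)
    k₀⸨X⸩ (coordMap k₀ (LS2 k₀) L) (coordMap_algebraMap k₀ (LS2 k₀) L)
    (not_isField_of_isLocalizationAway_C hX.ne_zero _)
    (fun Q _ hQ ↦ finite_quotient_of_isLocalizationAway_C hX k₀⸨X⸩ hQ) m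

theorem finiteDimensional_residueField (v : PrimeSpectrum (CoordRing k₀ L))
    (hv : v.asIdeal.IsMaximal) : FiniteDimensional k₀⸨X⸩ v.asIdeal.ResidueField :=
  have := finite_quotient_coordRing k₀ v.asIdeal (hm := hv)
  .of_surjective (IsScalarTower.toAlgHom k₀⸨X⸩ (CoordRing k₀ L ⧸ v.asIdeal)
    v.asIdeal.ResidueField).toLinearMap (Ideal.bijective_algebraMap_quotient_residueField _).2

end CoordRing

section ValuedField

theorem isModuleTopology_of_finiteDimensional (𝕜 E : Type*) [NontriviallyNormedField 𝕜]
    [CompleteSpace 𝕜] [NormedAddCommGroup E] [NormedSpace 𝕜 E] [FiniteDimensional 𝕜 E] :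
    IsModuleTopology 𝕜 E :=
  IsModuleTopology.iso (Module.finBasis 𝕜 E).equivFunL.symm

theorem isLocalHomeomorphOn_map_of_valued {k Γ₀ : Type*} [Field k]
    [LinearOrderedCommGroupWithZero Γ₀] [Valued k Γ₀] [(Valued.v : Valuation k Γ₀).RankOne]
    [CompleteSpace k] {S T : Type*} [CommRing S] [Algebra k S] [CommRing T] [Algebra k T]
    (φ : S →ₐ[k] T) {v : PrimeSpectrum T} (hφ : IsEtaleAtPoint (φ : S →+* T) v)
    (ℓ : Type*) [Field ℓ] [Algebra k ℓ] [FiniteDimensional k ℓ] :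
    IsLocalHomeomorphOn (Points.map φ : Points k T ℓ → Points k S ℓ)
      {p | RingHom.ker p = v.asIdeal} := by
  let : NontriviallyNormedField k := Valued.toNontriviallyNormedField k Γ₀
  have : IsUltrametricDist k := inferInstance
  let : NontriviallyNormedField ℓ := spectralNorm.nontriviallyNormedField k ℓ
  let : NormedAlgebra k ℓ := spectralNorm.normedAlgebra k ℓ
  have : IsModuleTopology k ℓ := isModuleTopology_of_finiteDimensional k ℓ
  have : CompleteSpace ℓ := FiniteDimensional.complete k ℓ
  exact isLocalHomeomorphOn_map_of_isEtaleAtPoint φ hφ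

theorem isRankOneDiscrete_laurentSeries (k₀ : Type*) [Field k₀] :
    (Valued.v : Valuation k₀⸨X⸩ _).IsRankOneDiscrete :=
  Valuation.IsRankOneDiscrete.mk' ((PowerSeries.idealX k₀).valuation k₀⸨X⸩)

end ValuedField

end ImplicitFunction

end

open ImplicitFunction in
theorem proposition2_general (k₀ : Type*) [Field k₀]
    (K : Type*) [Field K] [Algebra (PS2 k₀) K] [Algebra (LS2 k₀) K]
    [IsScalarTower (PS2 k₀) (LS2 k₀) K] [FiniteDimensional (LS2 k₀) K]
    (L : Type*) [Field L] [Algebra (PS2 k₀) L] [Algebra K L]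
    [IsScalarTower (PS2 k₀) K L] [FiniteDimensional K L]
    (v : PrimeSpectrum (CoordRing k₀ L)) (hv : v.asIdeal.IsMaximal)
    (hf : IsEtaleAtPoint (coordMap k₀ K L).toRingHom v) :
    FiniteDimensional k₀⸨X⸩ v.asIdeal.ResidueField ∧
      IsLocalHomeomorphOn
        (Points.map (ℓ := v.asIdeal.ResidueField) (coordMap k₀ K L))
        {Points.ofPrime k₀⸨X⸩ v} := by
  let : Algebra (LS2 k₀) L := ((algebraMap K L).comp (algebraMap (LS2 k₀) K)).toAlgebra
  have : IsScalarTower (LS2 k₀) K L := .of_algebraMap_eq' rfl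
  have : IsScalarTower (PS2 k₀) (LS2 k₀) L := .to₁₂₄ (PS2 k₀) (LS2 k₀) K L
  have : FiniteDimensional (LS2 k₀) L := Module.Finite.trans K L
  have hfin := finiteDimensional_residueField k₀ v hv
  have := isRankOneDiscrete_laurentSeries k₀
  -- Any real number greater than `1` can serve as the base `e` of the absolute value.
  let : (Valued.v : Valuation k₀⸨X⸩ _).RankOne :=
    Valuation.IsRankOneDiscrete.rankOne _ (e := 2) one_lt_two
  refine ⟨hfin, (isLocalHomeomorphOn_map_of_valued (coordMap k₀ K L) hf _).mono ?_⟩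
  exact Set.singleton_subset_iff.mpr (Ideal.ker_algebraMap_residueField v.asIdeal)

open ImplicitFunction in
theorem proposition2 (k₀ : Type*) [Field k₀] [PerfectField k₀]
    (K : Type*) [Field K] [Algebra (PS2 k₀) K] [Algebra (LS2 k₀) K]
    [IsScalarTower (PS2 k₀) (LS2 k₀) K] [FiniteDimensional (LS2 k₀) K]
    (L : Type*) [Field L] [Algebra (PS2 k₀) L] [Algebra K L]
    [IsScalarTower (PS2 k₀) K L] [FiniteDimensional K L]
    (v : PrimeSpectrum (CoordRing k₀ L)) (hv : v.asIdeal.IsMaximal)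
    (hf : IsEtaleAtPoint (coordMap k₀ K L).toRingHom v) :
    FiniteDimensional k₀⸨X⸩ v.asIdeal.ResidueField ∧
      IsLocalHomeomorphOn
        (Points.map (ℓ := v.asIdeal.ResidueField) (coordMap k₀ K L))
        {Points.ofPrime k₀⸨X⸩ v} :=
  proposition2_general k₀ K L v hv hf
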